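/- Let $SO_0(2,1)$ be the connected component of the unit in the group of real $3\times 3$ matrices $A$ with $AIA^TI=E_3$, $I=\operatorname{diag}(-1,1,1)$. Let $a=e_{12}+e_{21}$, $b=e_{13}+e_{31}$, $c=e_{32}-e_{23}$ be the basis of its Lie algebra, where $e_{ij}$ are the matrix units. Let $d$ be the left-invariant sub-Riemannian metric on $SO_0(2,1)$ defined by the left-invariant distribution $D$ with $D(e)=\operatorname{Lin}(a,b)$ and the scalar product on $D(e)$ with orthonormal basis $a,b$: $d(g,h)$ is the infimum of the lengths $\int_{s_0}^{s_1}\sqrt{u_1^2+u_2^2}\,ds$ of the absolutely continuous curves $\gamma:[s_0,s_1]\to SO_0(2,1)$ from $g$ to $h$ with $\gamma'=\gamma\,(u_1a+u_2b)$ almost everywhere, where $u_1,u_2$ are integrable. For $\beta,\phi_0\in\mathbb{R}$ let $$\gamma(t)=\gamma_{\beta,\phi_0}(t)=\exp\bigl(t(\cos\phi_0\,a+\sin\phi_0\,b-\beta c)\bigr)\exp(t\beta c),\qquad t\in\mathbb{R},$$ be the geodesic of $(SO_0(2,1),d)$ with origin at the unit and parameters $\beta,\phi_0$. Lemma. Suppose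 that $\beta=0$. Then for all $\phi_0\in\mathbb{R}$, $g\in SO_0(2,1)$ and $t_1\ge 0$, the segment $g\gamma(t)$, $0\le t\le t_1$, lies in $SO_0(2,1)$, is parametrized by arclength (the part over $[0,t]$ has length $t$ in the metric $d$ for every $t\in[0,t_1]$), and is a shortest arc in $(SO_0(2,1),d)$: a $d$-continuous curve whose length, measured in the metric $d$, is finite and equal to the distance $d(g\gamma(0),g\gamma(t_1))$ between its ends. In particular (for $g=e$) every segment $\gamma(t)$, $0\le t\le t_1$, is a shortest arc. -/

import Mathlib

open scoped ENNReal Topology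

noncomputable section

/-- The matrix `I` of the time reversing operator `(t, x) ↦ (-t, x)` of Minkowski space-time
`ℝ³` (the time coordinate is the first one). -/
def timeReversal : Matrix (Fin 3) (Fin 3) ℝ := Matrix.diagonal ![-1, 1, 1]

/-- The group `P(2,1)` of all real `3 × 3` matrices that preserve the pseudoscalar product
`-ts + (x, y)`, as a set of matrices with its usual topology: `A I Aᵀ I = 1`. -/
def pseudoIsometries : Set (Matrix (Fin 3) (Fin 3) ℝ) :=
  {A | A * timeReversal * A.transpose * timeReversal = 1}

/-- The Lorentz group `SO₀(2,1)`: the connected component of the unit in `P(2,1)`. -/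
def lorentzSO : Set (Matrix (Fin 3) (Fin 3) ℝ) := connectedComponentIn pseudoIsometries 1

/-- `a = e₁₂ + e₂₁`. -/
def soA : Matrix (Fin 3) (Fin 3) ℝ := !![0, 1, 0; 1, 0, 0; 0, 0, 0]

/-- `b = e₁₃ + e₃₁`. -/
def soB : Matrix (Fin 3) (Fin 3) ℝ := !![0, 0, 1; 0, 0, 0; 1, 0, 0]

/-- `c = e₃₂ - e₂₃`. -/
def soC : Matrix (Fin 3) (Fin 3) ℝ := !![0, 0, 0; 0, 0, -1; 0, 1, 0]

/-- `γ` on `[s₀, s₁]` is an absolutely continuous curve in `SO₀(2,1)` that is tangent almost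
everywhere to the left-invariant distribution `D(g) = g · Lin(a, b)`; the functions `u₁, u₂` are
the coordinates of `γ⁻¹ γ'` in the basis `a, b`. Absolute continuity and derivatives are meant
entrywise. -/
structure IsHorizontalCurve (γ : ℝ → Matrix (Fin 3) (Fin 3) ℝ) (u₁ u₂ : ℝ → ℝ) (s₀ s₁ : ℝ) :
    Prop where
  le : s₀ ≤ s₁
  mem : ∀ s ∈ Set.Icc s₀ s₁, γ s ∈ lorentzSO
  absolutelyContinuous : ∀ i j, AbsolutelyContinuousOnInterval (fun s => γ s i j) s₀ s₁
  integrable₁ : IntervalIntegrable u₁ MeasureTheory.volume s₀ s₁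
  integrable₂ : IntervalIntegrable u₂ MeasureTheory.volume s₀ s₁
  hasDerivAt : ∀ᵐ s ∂(MeasureTheory.volume.restrict (Set.Icc s₀ s₁)),
    ∀ i j, HasDerivAt (fun r => γ r i j) ((γ s * (u₁ s • soA + u₂ s • soB)) i j) s

/-- The length of a horizontal curve for the left-invariant scalar product on `D` for which
`a, b` is an orthonormal basis of `D(e)`. -/
def horizontalLength (u₁ u₂ : ℝ → ℝ) (s₀ s₁ : ℝ) : ℝ :=
  ∫ s in s₀..s₁, Real.sqrt (u₁ s ^ 2 + u₂ s ^ 2)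

/-- The left-invariant sub-Riemannian metric `d` on `SO₀(2,1)`: the infimum of the lengths of the
horizontal curves from `g` to `h`; it is `∞` if there is no such curve. -/
def subRiemannianDist (g h : Matrix (Fin 3) (Fin 3) ℝ) : ℝ≥0∞ :=
  sInf {L | ∃ (γ : ℝ → Matrix (Fin 3) (Fin 3) ℝ) (u₁ u₂ : ℝ → ℝ) (s₀ s₁ : ℝ),
    IsHorizontalCurve γ u₁ u₂ s₀ s₁ ∧ γ s₀ = g ∧ γ s₁ = h ∧
      L = ENNReal.ofReal (horizontalLength u₁ u₂ s₀ s₁)}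

/-- The length of the curve `γ` on `[s₀, s₁]` for a distance function `d`: the supremum of the
sums of distances of consecutive points over all finite subdivisions. -/
def metricLength {X : Type*} (d : X → X → ℝ≥0∞) (γ : ℝ → X) (s₀ s₁ : ℝ) : ℝ≥0∞ :=
  sSup {L | ∃ (n : ℕ) (τ : ℕ → ℝ), Monotone τ ∧ (∀ i, τ i ∈ Set.Icc s₀ s₁) ∧
    L = ∑ i ∈ Finset.range n, d (γ (τ i)) (γ (τ (i + 1)))}

/-- `γ` on `[s₀, s₁]` is a shortest arc for the distance function `d`: a continuous curve whose
length is finite and equal to the distance of its ends. -/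
structure IsShortestArc {X : Type*} (d : X → X → ℝ≥0∞) (γ : ℝ → X) (s₀ s₁ : ℝ) : Prop where
  le : s₀ ≤ s₁
  continuous : ∀ t ∈ Set.Icc s₀ s₁,
    Filter.Tendsto (fun s => d (γ s) (γ t)) (𝓝[Set.Icc s₀ s₁] t) (𝓝 0)
  length_ne_top : metricLength d γ s₀ s₁ ≠ ∞
  length_eq : metricLength d γ s₀ s₁ = d (γ s₀) (γ s₁)

/-- The geodesic `γ(t) = exp(t (cos φ₀ a + sin φ₀ b - β c)) exp(t β c)` of `(SO₀(2,1), d)`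
with origin at the unit. -/
def lorentzGeodesic (β φ₀ t : ℝ) : Matrix (Fin 3) (Fin 3) ℝ :=
  NormedSpace.exp (t • (Real.cos φ₀ • soA + Real.sin φ₀ • soB - β • soC)) *
    NormedSpace.exp ((t * β) • soC)

end

open MeasureTheory Set

/-! For `β = 0` the geodesic is the horizontal one-parameter subgroup of X = cos φ a + sin φ b, with
unit speed, so the distance from `g` to `g γ(t)` is at most t for t ≥ 0. The lower bound is a
calibration. Let ℓ = (1, cos φ, sin φ), a lightlike covector, and let f(A) be the time component of
ℓA. Elements of the group keep ℓA lightlike, so by Cauchy–Schwarz |f'| ≤ |u| |f| along a horizontal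
curve (`lightRow_sq`, `abs_horizontal_le_sqrt_mul`), and Grönwall bounds the growth of |f| by
exp(length) (`IsHorizontalCurve.abs_lightRow_le`). Since ℓX = ℓ, f(γ(t)) = exp t while f(1) = 1, so
every competitor has length at least t. Hence `t ↦ g γ(t)` is an isometric embedding of the line,
which gives all the metric claims. -/

/-! ### Absolutely continuous functions and Grönwall's inequality -/

/-- Postcomposition with a continuously differentiable function preserves absolute continuity. -/
theorem AbsolutelyContinuousOnInterval.contDiff_comp {f h : ℝ → ℝ} {a b : ℝ}
    (hf : AbsolutelyContinuousOnInterval f a b) (hh : ContDiff ℝ 1 h) :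
    AbsolutelyContinuousOnInterval (fun x => h (f x)) a b := by
  obtain ⟨C, hC⟩ := hf.exists_bound
  obtain ⟨K, hK⟩ := (hh.contDiffOn (s := Icc (-C) C)).exists_lipschitzOnWith (by decide)
    (convex_Icc _ _) isCompact_Icc
  have hmem : ∀ x ∈ uIcc a b, f x ∈ Icc (-C) C := fun x hx => abs_le.1 (hC x hx)
  rw [absolutelyContinuousOnInterval_iff] at hf ⊢
  intro ε hε
  -- `K + 1` rather than `K`, since the Lipschitz constant may be zero.
  obtain ⟨δ, hδ, H⟩ := hf (ε / (K + 1)) (by positivity)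
  refine ⟨δ, hδ, fun E hE hlt => ?_⟩
  have hK0 : (0 : ℝ) ≤ K := K.2
  have h1 := H E hE hlt
  have h2 : ∑ i ∈ Finset.range E.1, dist (h (f (E.2 i).1)) (h (f (E.2 i).2)) ≤
      K * ∑ i ∈ Finset.range E.1, dist (f (E.2 i).1) (f (E.2 i).2) := by
    rw [Finset.mul_sum]
    refine Finset.sum_le_sum fun i hi => ?_
    have hm := hE.1 i hi
    exact hK.dist_le_mul _ (hmem _ hm.1) _ (hmem _ hm.2)
  have h3 : 0 ≤ ∑ i ∈ Finset.range E.1, dist (f (E.2 i).1) (f (E.2 i).2) :=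
    Finset.sum_nonneg fun _ _ => dist_nonneg
  rw [lt_div_iff₀ (by positivity)] at h1
  nlinarith

/-- An absolutely continuous function whose derivative is almost everywhere nonpositive does not
increase. -/
theorem AbsolutelyContinuousOnInterval.le_of_ae_hasDerivAt_nonpos {f : ℝ → ℝ} {a b : ℝ}
    (hab : a ≤ b) (hf : AbsolutelyContinuousOnInterval f a b)
    (h : ∀ᵐ x ∂(volume.restrict (Icc a b)), ∃ y ≤ 0, HasDerivAt f y x) : f b ≤ f a := by
  rw [← sub_nonpos, ← hf.integral_deriv_eq_sub, intervalIntegral.integral_of_le hab,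
    ← integral_Icc_eq_integral_Ioc]
  refine integral_nonpos_of_ae ?_
  filter_upwards [h] with x ⟨y, hy, hx⟩
  simpa [hx.deriv] using hy

/-- **Grönwall's inequality** for absolutely continuous functions with an integrable rate. -/
theorem AbsolutelyContinuousOnInterval.abs_le_mul_exp_integral {w L : ℝ → ℝ} {a b : ℝ}
    (hab : a ≤ b) (hw : AbsolutelyContinuousOnInterval w a b)
    (hL : IntervalIntegrable L volume a b)
    (h : ∀ᵐ x ∂(volume.restrict (Icc a b)), ∃ y, HasDerivAt w y x ∧ |y| ≤ L x * |w x|) :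
    |w b| ≤ |w a| * Real.exp (∫ x in a..b, L x) := by
  have hac := hL.absolutelyContinuousOnInterval_intervalIntegral (c := a) (by simp)
  have hE : AbsolutelyContinuousOnInterval
      (fun x => Real.exp (-2 * ∫ v in a..x, L v)) a b :=
    hac.contDiff_comp (h := fun y => Real.exp (-2 * y)) (by fun_prop)
  -- w² exp(-2∫L) does not increase; squaring avoids differentiating |w| at the zeros of w.
  have key := ((hw.mul hw).mul hE).le_of_ae_hasDerivAt_nonpos hab (by
    have hd := hL.ae_hasDerivAt_integral
    rw [uIcc_of_le hab] at hd
    filter_upwards [h, ae_restrict_of_ae hd, ae_restrict_mem measurableSet_Icc] with x hx hd hm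
    obtain ⟨y, hy, hle⟩ := hx
    have hI := hd hm a (left_mem_Icc.2 hab)
    refine ⟨_, ?_, (hy.mul hy).mul (hI.const_mul (-2)).exp⟩
    have h1 : y * w x ≤ L x * (w x * w x) := by
      calc y * w x ≤ |y| * |w x| := (le_abs_self _).trans_eq (abs_mul _ _)
        _ ≤ L x * |w x| * |w x| := by gcongr
        _ = L x * (w x * w x) := by rw [mul_assoc, abs_mul_abs_self]
    have h2 := Real.exp_pos (-2 * ∫ v in a..x, L v)
    simp only [Pi.mul_apply]
    nlinarith [mul_le_mul_of_nonneg_left h1 h2.le])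
  simp only [Pi.mul_apply, intervalIntegral.integral_same, mul_zero, Real.exp_zero, mul_one] at key
  set J := ∫ x in a..b, L x
  refine abs_le_of_sq_le_sq ?_ (by positivity)
  rw [mul_pow, sq_abs]
  have e1 : Real.exp (-2 * J) * Real.exp J ^ 2 = 1 := by
    rw [sq, ← Real.exp_add, ← Real.exp_add]; simp; ring
  have e2 := Real.exp_pos J
  nlinarith [mul_le_mul_of_nonneg_right key (sq_nonneg (Real.exp J))]

/-! ### The group of pseudoisometries -/

theorem timeReversal_mul_self : timeReversal * timeReversal = 1 := by
  rw [timeReversal, Matrix.diagonal_mul_diagonal, ← Matrix.diagonal_one]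
  congr 1
  ext i
  fin_cases i <;> simp

theorem transpose_timeReversal : timeReversal.transpose = timeReversal :=
  Matrix.diagonal_transpose _

theorem lorentzSO_subset_pseudoIsometries : lorentzSO ⊆ pseudoIsometries :=
  connectedComponentIn_subset _ _

theorem mul_timeReversal_mul_transpose {A : Matrix (Fin 3) (Fin 3) ℝ}
    (hA : A ∈ pseudoIsometries) : A * timeReversal * A.transpose = timeReversal := by
  have h : A * timeReversal * A.transpose * timeReversal = 1 := hA
  calc A * timeReversal * A.transpose
      = A * timeReversal * A.transpose * timeReversal * timeReversal := by
        rw [mul_assoc _ timeReversal timeReversal, timeReversal_mul_self, mul_one]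
    _ = timeReversal := by rw [h, one_mul]

theorem mul_mem_pseudoIsometries {A B : Matrix (Fin 3) (Fin 3) ℝ} (hA : A ∈ pseudoIsometries)
    (hB : B ∈ pseudoIsometries) : A * B ∈ pseudoIsometries := by
  change A * B * timeReversal * (A * B).transpose * timeReversal = 1
  calc A * B * timeReversal * (A * B).transpose * timeReversal
      = A * (B * timeReversal * B.transpose) * A.transpose * timeReversal := by
        rw [Matrix.transpose_mul]; noncomm_ring
    _ = 1 := by rw [mul_timeReversal_mul_transpose hB]; exact hA

theorem exists_left_inverse_mem_pseudoIsometries {A : Matrix (Fin 3) (Fin 3) ℝ}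
    (hA : A ∈ pseudoIsometries) : ∃ B ∈ pseudoIsometries, B * A = 1 := by
  have h : timeReversal * A.transpose * timeReversal * A = 1 := by
    rw [mul_eq_one_comm, ← mul_assoc, ← mul_assoc]; exact hA
  refine ⟨_, ?_, h⟩
  change timeReversal * A.transpose * timeReversal * timeReversal *
    (timeReversal * A.transpose * timeReversal).transpose * timeReversal = 1
  simp only [Matrix.transpose_mul, Matrix.transpose_transpose, transpose_timeReversal]
  calc timeReversal * A.transpose * timeReversal * timeReversal *
        (timeReversal * (A * timeReversal)) * timeReversal
      = timeReversal * A.transpose * (timeReversal * timeReversal) *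
        timeReversal * A * (timeReversal * timeReversal) := by noncomm_ring
    _ = 1 := by rw [timeReversal_mul_self, mul_one, mul_one, h]

/-! ### Horizontal one-parameter subgroups -/

/-- The unit horizontal vector `cos φ • a + sin φ • b` of the Lie algebra. -/
noncomputable def unitHorizontal (φ : ℝ) : Matrix (Fin 3) (Fin 3) ℝ := Real.cos φ • soA + Real.sin φ • soB

theorem lorentzGeodesic_zero (φ t : ℝ) :
    lorentzGeodesic 0 φ t = NormedSpace.exp (t • unitHorizontal φ) := by
  simp [lorentzGeodesic, unitHorizontal]

theorem unitHorizontal_eq (φ : ℝ) : unitHorizontal φ =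
    !![0, Real.cos φ, Real.sin φ; Real.cos φ, 0, 0; Real.sin φ, 0, 0] := by
  ext i j
  fin_cases i <;> fin_cases j <;> simp [unitHorizontal, soA, soB]

theorem unitHorizontal_isSymm (φ : ℝ) : (unitHorizontal φ).IsSymm := by
  ext i j
  fin_cases i <;> fin_cases j <;> simp [unitHorizontal_eq]

theorem unitHorizontal_add_pi (φ : ℝ) : unitHorizontal (φ + Real.pi) = -unitHorizontal φ := by
  ext i j
  fin_cases i <;> fin_cases j <;> simp [unitHorizontal_eq]

theorem timeReversal_conj_unitHorizontal (φ : ℝ) :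
    timeReversal * unitHorizontal φ * timeReversal = -unitHorizontal φ := by
  ext i j
  fin_cases i <;> fin_cases j <;>
    simp [unitHorizontal_eq, timeReversal]

theorem lorentzGeodesic_zero_zero (φ : ℝ) : lorentzGeodesic 0 φ 0 = 1 := by
  simp [lorentzGeodesic_zero]

theorem lorentzGeodesic_zero_add (φ s t : ℝ) :
    lorentzGeodesic 0 φ (s + t) = lorentzGeodesic 0 φ s * lorentzGeodesic 0 φ t := by
  simp only [lorentzGeodesic_zero, add_smul]
  exact Matrix.exp_add_of_commute _ _ (((Commute.refl _).smul_left _).smul_right _)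

theorem lorentzGeodesic_zero_add_pi (φ t : ℝ) :
    lorentzGeodesic 0 (φ + Real.pi) t = lorentzGeodesic 0 φ (-t) := by
  simp [lorentzGeodesic_zero, unitHorizontal_add_pi]

/-- X is symmetric and conjugation by `timeReversal` negates it, so the defining product reduces to
γ(t) γ(-t) = 1. -/
theorem lorentzGeodesic_zero_mem_pseudoIsometries (φ t : ℝ) :
    lorentzGeodesic 0 φ t ∈ pseudoIsometries := by
  have hinv : timeReversal⁻¹ = timeReversal := Matrix.inv_eq_left_inv timeReversal_mul_self
  have hunit : IsUnit timeReversal := IsUnit.of_mul_eq_one _ timeReversal_mul_self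
  have hsymm : (lorentzGeodesic 0 φ t).transpose = lorentzGeodesic 0 φ t := by
    rw [lorentzGeodesic_zero]
    exact ((unitHorizontal_isSymm φ).smul t).exp
  have hconj : timeReversal * lorentzGeodesic 0 φ t * timeReversal =
      lorentzGeodesic 0 φ (-t) := by
    have h := Matrix.exp_conj timeReversal (t • unitHorizontal φ) hunit
    rw [hinv] at h
    rw [lorentzGeodesic_zero, ← h, lorentzGeodesic_zero, Matrix.mul_smul, Matrix.smul_mul,
      timeReversal_conj_unitHorizontal, smul_neg, neg_smul]
  change lorentzGeodesic 0 φ t * timeReversal * (lorentzGeodesic 0 φ t).transpose *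
    timeReversal = 1
  rw [hsymm, mul_assoc, mul_assoc, ← mul_assoc timeReversal, hconj, ← lorentzGeodesic_zero_add,
    add_neg_cancel, lorentzGeodesic_zero_zero]

open scoped Matrix.Norms.Operator in
theorem hasDerivAt_mul_lorentzGeodesic_zero (g : Matrix (Fin 3) (Fin 3) ℝ) (φ t : ℝ)
    (i j : Fin 3) :
    HasDerivAt (fun s => (g * lorentzGeodesic 0 φ s) i j)
      ((g * lorentzGeodesic 0 φ t * unitHorizontal φ) i j) t := by
  have h := (hasDerivAt_exp_smul_const (𝕂 := ℝ) (unitHorizontal φ) t).const_mul g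
  simp only [← mul_assoc] at h
  simp only [lorentzGeodesic_zero]
  exact hasDerivAt_pi.1 (hasDerivAt_pi.1 h i) j

theorem continuous_mul_lorentzGeodesic_zero (g : Matrix (Fin 3) (Fin 3) ℝ) (φ : ℝ) :
    Continuous fun t => g * lorentzGeodesic 0 φ t :=
  continuous_matrix fun i j => continuous_iff_continuousAt.2 fun t =>
    (hasDerivAt_mul_lorentzGeodesic_zero g φ t i j).continuousAt

/-- The whole curve is connected and passes through `g` at time 0, so it stays in the component of
`g`. -/
theorem mul_lorentzGeodesic_zero_mem {g : Matrix (Fin 3) (Fin 3) ℝ} (hg : g ∈ lorentzSO)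
    (φ t : ℝ) : g * lorentzGeodesic 0 φ t ∈ lorentzSO := by
  have hsub : range (fun t => g * lorentzGeodesic 0 φ t) ⊆
      connectedComponentIn pseudoIsometries g :=
    (isPreconnected_range (continuous_mul_lorentzGeodesic_zero g φ)).subset_connectedComponentIn
      ⟨0, by simp [lorentzGeodesic_zero_zero]⟩ (by
        rintro _ ⟨s, rfl⟩
        exact mul_mem_pseudoIsometries (lorentzSO_subset_pseudoIsometries hg)
          (lorentzGeodesic_zero_mem_pseudoIsometries φ s))
  rw [lorentzSO, connectedComponentIn_eq hg]
  exact hsub ⟨t, rfl⟩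

theorem isHorizontalCurve_mul_lorentzGeodesic_zero {g : Matrix (Fin 3) (Fin 3) ℝ}
    (hg : g ∈ lorentzSO) (φ : ℝ) {s₀ s₁ : ℝ} (h : s₀ ≤ s₁) :
    IsHorizontalCurve (fun t => g * lorentzGeodesic 0 φ t) (fun _ => Real.cos φ)
      (fun _ => Real.sin φ) s₀ s₁ where
  le := h
  mem s _ := mul_lorentzGeodesic_zero_mem hg φ s
  absolutelyContinuous i j := by
    refine ContDiffOn.absolutelyContinuousOnInterval (ContDiff.contDiffOn ?_)
    have hd := hasDerivAt_mul_lorentzGeodesic_zero g φ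
    refine contDiff_one_iff_deriv.2 ⟨fun t => (hd t i j).differentiableAt, ?_⟩
    rw [funext fun t => (hd t i j).deriv]
    exact ((continuous_mul_lorentzGeodesic_zero g φ).mul continuous_const).matrix_elem i j
  integrable₁ := intervalIntegrable_const
  integrable₂ := intervalIntegrable_const
  hasDerivAt := Filter.Eventually.of_forall fun s i j =>
    hasDerivAt_mul_lorentzGeodesic_zero g φ s i j

theorem subRiemannianDist_lorentzGeodesic_zero_le {g : Matrix (Fin 3) (Fin 3) ℝ}
    (hg : g ∈ lorentzSO) (φ : ℝ) {t : ℝ} (ht : 0 ≤ t) :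
    subRiemannianDist g (g * lorentzGeodesic 0 φ t) ≤ ENNReal.ofReal t :=
  sInf_le ⟨_, _, _, 0, t, isHorizontalCurve_mul_lorentzGeodesic_zero hg φ ht,
    by simp [lorentzGeodesic_zero_zero], rfl, by simp [horizontalLength]⟩

/-! ### The calibrating lightlike covector -/

/-- The row `(1, cos φ, sin φ) * A`: the lightlike covector `(1, cos φ, sin φ)` moved by `A`. -/
noncomputable def lightRow (φ : ℝ) (A : Matrix (Fin 3) (Fin 3) ℝ) (j : Fin 3) : ℝ :=
  A 0 j + Real.cos φ * A 1 j + Real.sin φ * A 2 j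

theorem lightRow_sq {A : Matrix (Fin 3) (Fin 3) ℝ} (hA : A ∈ pseudoIsometries) (φ : ℝ) :
    lightRow φ A 0 ^ 2 = lightRow φ A 1 ^ 2 + lightRow φ A 2 ^ 2 := by
  have h := mul_timeReversal_mul_transpose hA
  have h' : ∀ i j, -(A i 0 * A j 0) + A i 1 * A j 1 + A i 2 * A j 2 = timeReversal i j :=
    fun i j => by
      rw [← h]
      simp [Matrix.mul_apply, Fin.sum_univ_three, timeReversal, Matrix.diagonal]
  have h00 := h' 0 0
  have h11 := h' 1 1
  have h22 := h' 2 2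
  have h01 := h' 0 1
  have h02 := h' 0 2
  have h12 := h' 1 2
  simp [timeReversal, Matrix.diagonal] at h00 h11 h22 h01 h02 h12
  simp only [lightRow]
  -- This expands ℓ(A I Aᵀ)ℓᵀ = ℓIℓᵀ = -1 + cos² φ + sin² φ = 0.
  linear_combination -h00 - Real.cos φ ^ 2 * h11 - Real.sin φ ^ 2 * h22 -
    2 * Real.cos φ * h01 - 2 * Real.sin φ * h02 - 2 * Real.cos φ * Real.sin φ * h12 -
    Real.sin_sq_add_cos_sq φ

theorem lightRow_mul_unitHorizontal (φ : ℝ) (A : Matrix (Fin 3) (Fin 3) ℝ) (u₁ u₂ : ℝ) :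
    lightRow φ (A * (u₁ • soA + u₂ • soB)) 0 = u₁ * lightRow φ A 1 + u₂ * lightRow φ A 2 := by
  simp [lightRow, Matrix.mul_apply, Fin.sum_univ_three, soA, soB]
  ring

theorem lightRow_unitHorizontal_mul (φ : ℝ) (A : Matrix (Fin 3) (Fin 3) ℝ) (j : Fin 3) :
    lightRow φ (unitHorizontal φ * A) j = lightRow φ A j := by
  simp [lightRow, Matrix.mul_apply, Fin.sum_univ_three, unitHorizontal_eq]
  linear_combination A 0 j * Real.sin_sq_add_cos_sq φ

theorem HasDerivAt.lightRow {φ t : ℝ} {γ : ℝ → Matrix (Fin 3) (Fin 3) ℝ}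
    {A : Matrix (Fin 3) (Fin 3) ℝ} (h : ∀ i j, HasDerivAt (fun s => γ s i j) (A i j) t)
    (j : Fin 3) : HasDerivAt (fun s => lightRow φ (γ s) j) (lightRow φ A j) t :=
  ((h 0 j).add ((h 1 j).const_mul _)).add ((h 2 j).const_mul _)

open scoped Matrix.Norms.Operator in
theorem commute_unitHorizontal_lorentzGeodesic_zero (φ t : ℝ) :
    Commute (unitHorizontal φ) (lorentzGeodesic 0 φ t) := by
  rw [lorentzGeodesic_zero]
  exact ((Commute.refl _).smul_right t).exp_right

/-- The lightlike covector `(1, cos φ, sin φ)` is an eigenvector of the geodesic. -/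
theorem lightRow_lorentzGeodesic_zero (φ t : ℝ) :
    lightRow φ (lorentzGeodesic 0 φ t) 0 = Real.exp t := by
  have hd : ∀ s, HasDerivAt (fun r => lightRow φ (lorentzGeodesic 0 φ r) 0)
      (lightRow φ (lorentzGeodesic 0 φ s) 0) s := fun s => by
    have h := HasDerivAt.lightRow (φ := φ)
      (fun i j => hasDerivAt_mul_lorentzGeodesic_zero 1 φ s i j) 0
    simpa only [one_mul, ← (commute_unitHorizontal_lorentzGeodesic_zero φ s).eq,
      lightRow_unitHorizontal_mul] using h
  -- f solves f' = f along the geodesic, so f(γ(r)) exp(-r) is constant.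
  have hc : ∀ s, HasDerivAt
      (fun r => lightRow φ (lorentzGeodesic 0 φ r) 0 * Real.exp (-r)) 0 s := fun s => by
    refine ((hd s).mul (hasDerivAt_neg s).exp).congr_deriv ?_
    ring
  have h := is_const_of_deriv_eq_zero (fun s => (hc s).differentiableAt)
    (fun s => (hc s).deriv) t 0
  simp only [lorentzGeodesic_zero_zero, neg_zero, Real.exp_zero, mul_one, Real.exp_neg] at h
  rw [mul_inv_eq_iff_eq_mul₀ (Real.exp_ne_zero t)] at h
  rw [h]
  simp [lightRow]

theorem abs_horizontal_le_sqrt_mul {u₁ u₂ x y z : ℝ} (h : x ^ 2 = y ^ 2 + z ^ 2) :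
    |u₁ * y + u₂ * z| ≤ √(u₁ ^ 2 + u₂ ^ 2) * |x| := by
  rw [← Real.sqrt_sq_eq_abs x, h, ← Real.sqrt_mul (by positivity)]
  refine Real.abs_le_sqrt ?_
  nlinarith [sq_nonneg (u₁ * z - u₂ * y)]

theorem IsHorizontalCurve.intervalIntegrable_speed {γ : ℝ → Matrix (Fin 3) (Fin 3) ℝ}
    {u₁ u₂ : ℝ → ℝ} {s₀ s₁ : ℝ} (h : IsHorizontalCurve γ u₁ u₂ s₀ s₁) :
    IntervalIntegrable (fun s => √(u₁ s ^ 2 + u₂ s ^ 2)) volume s₀ s₁ := by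
  have h₁ := h.integrable₁
  have h₂ := h.integrable₂
  refine (h₁.abs.add h₂.abs).mono_fun ?_ ?_
  · exact Real.continuous_sqrt.comp_aestronglyMeasurable
      ((h₁.aestronglyMeasurable_restrict_uIoc.pow 2).add
        (h₂.aestronglyMeasurable_restrict_uIoc.pow 2))
  · refine Filter.Eventually.of_forall fun s => ?_
    simp only [Real.norm_eq_abs, abs_of_nonneg (Real.sqrt_nonneg _)]
    rw [abs_of_nonneg (by positivity)]
    refine Real.sqrt_le_iff.2 ⟨by positivity, ?_⟩
    nlinarith [sq_abs (u₁ s), sq_abs (u₂ s), abs_nonneg (u₁ s), abs_nonneg (u₂ s),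
      mul_nonneg (abs_nonneg (u₁ s)) (abs_nonneg (u₂ s))]

/-- Along a horizontal curve the time component of a left-translated lightlike covector grows at
most exponentially in the length. -/
theorem IsHorizontalCurve.abs_lightRow_le {γ : ℝ → Matrix (Fin 3) (Fin 3) ℝ}
    {u₁ u₂ : ℝ → ℝ} {s₀ s₁ : ℝ} (h : IsHorizontalCurve γ u₁ u₂ s₀ s₁)
    {B : Matrix (Fin 3) (Fin 3) ℝ} (hB : B ∈ pseudoIsometries) (φ : ℝ) :
    |lightRow φ (B * γ s₁) 0| ≤
      |lightRow φ (B * γ s₀) 0| * Real.exp (horizontalLength u₁ u₂ s₀ s₁) := by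
  have hmul : ∀ i, AbsolutelyContinuousOnInterval (fun s => (B * γ s) i 0) s₀ s₁ := fun i => by
    simp only [Matrix.mul_apply, Fin.sum_univ_three]
    exact (((h.absolutelyContinuous 0 0).const_mul _).add
      ((h.absolutelyContinuous 1 0).const_mul _)).add ((h.absolutelyContinuous 2 0).const_mul _)
  refine AbsolutelyContinuousOnInterval.abs_le_mul_exp_integral
    (w := fun s => lightRow φ (B * γ s) 0) h.le
    (((hmul 0).add ((hmul 1).const_mul _)).add ((hmul 2).const_mul _))
    h.intervalIntegrable_speed ?_
  filter_upwards [h.hasDerivAt, ae_restrict_mem measurableSet_Icc] with s hs hm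
  refine ⟨_, HasDerivAt.lightRow (A := B * γ s * (u₁ s • soA + u₂ s • soB)) (fun i j => ?_) 0, ?_⟩
  · rw [mul_assoc]
    simp only [Matrix.mul_apply (M := B)]
    exact HasDerivAt.fun_sum fun k _ => (hs k j).const_mul _
  · rw [lightRow_mul_unitHorizontal]
    exact abs_horizontal_le_sqrt_mul (lightRow_sq (mul_mem_pseudoIsometries hB
      (lorentzSO_subset_pseudoIsometries (h.mem s hm))) φ)

/-! ### Distances along the geodesic -/

theorem le_subRiemannianDist_lorentzGeodesic_zero {g : Matrix (Fin 3) (Fin 3) ℝ}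
    (hg : g ∈ lorentzSO) (φ t : ℝ) :
    ENNReal.ofReal t ≤ subRiemannianDist g (g * lorentzGeodesic 0 φ t) := by
  refine le_sInf ?_
  rintro _ ⟨γ, u₁, u₂, s₀, s₁, h, h₀, h₁, rfl⟩
  -- Translating by the inverse of `g` makes the competitor start at the unit, where f = 1.
  obtain ⟨B, hB, hBg⟩ :=
    exists_left_inverse_mem_pseudoIsometries (lorentzSO_subset_pseudoIsometries hg)
  have key := h.abs_lightRow_le hB φ
  rw [h₀, h₁, ← mul_assoc, hBg, one_mul, lightRow_lorentzGeodesic_zero, Real.abs_exp] at key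
  refine ENNReal.ofReal_le_ofReal (Real.exp_le_exp.1 (key.trans_eq ?_))
  simp [lightRow]

theorem subRiemannianDist_lorentzGeodesic_zero {g : Matrix (Fin 3) (Fin 3) ℝ}
    (hg : g ∈ lorentzSO) (φ s t : ℝ) :
    subRiemannianDist (g * lorentzGeodesic 0 φ s) (g * lorentzGeodesic 0 φ t) =
      ENNReal.ofReal |t - s| := by
  have main : ∀ (ψ : ℝ) {r : ℝ}, 0 ≤ r → subRiemannianDist (g * lorentzGeodesic 0 φ s)
      (g * lorentzGeodesic 0 φ s * lorentzGeodesic 0 ψ r) = ENNReal.ofReal r := fun ψ r hr =>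
    le_antisymm
      (subRiemannianDist_lorentzGeodesic_zero_le (mul_lorentzGeodesic_zero_mem hg φ s) ψ hr)
      (le_subRiemannianDist_lorentzGeodesic_zero (mul_lorentzGeodesic_zero_mem hg φ s) ψ r)
  rcases le_total s t with h | h
  · rw [abs_of_nonneg (sub_nonneg.2 h), ← main φ (sub_nonneg.2 h), mul_assoc,
      ← lorentzGeodesic_zero_add, add_sub_cancel]
  -- Backward in time is forward along the geodesic of the opposite direction φ + π.
  · rw [abs_of_nonpos (sub_nonpos.2 h), neg_sub, ← main (φ + Real.pi) (sub_nonneg.2 h),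
      lorentzGeodesic_zero_add_pi, mul_assoc, ← lorentzGeodesic_zero_add, neg_sub, add_sub_cancel]

/-! ### Metric length and shortest arcs -/

/-- A curve along which the distance is the difference of the parameters is parametrized by
arclength. -/
theorem metricLength_eq_of_dist_eq {X : Type*} {d : X → X → ℝ≥0∞} {γ : ℝ → X}
    (h : ∀ s t, d (γ s) (γ t) = ENNReal.ofReal |t - s|) {s₀ s₁ : ℝ} (hs : s₀ ≤ s₁) :
    metricLength d γ s₀ s₁ = ENNReal.ofReal (s₁ - s₀) := by
  -- Sums over subdivisions telescope to at most s₁ - s₀; the subdivision by the two ends attains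
  -- it.
  refine le_antisymm (sSup_le ?_) (le_sSup ⟨1, fun i => if i = 0 then s₀ else s₁, ?_, ?_, ?_⟩)
  · rintro _ ⟨n, τ, hτ, hmem, rfl⟩
    have hstep : ∀ i, 0 ≤ τ (i + 1) - τ i := fun i => sub_nonneg.2 (hτ i.le_succ)
    simp only [h, abs_of_nonneg (hstep _)]
    rw [← ENNReal.ofReal_sum_of_nonneg fun i _ => hstep i, Finset.sum_range_sub]
    exact ENNReal.ofReal_le_ofReal (sub_le_sub (hmem n).2 (hmem 0).1)
  · refine monotone_nat_of_le_succ fun i => ?_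
    by_cases hi : i = 0 <;> simp [hi, hs]
  · intro i
    by_cases hi : i = 0 <;> simp [hi, hs]
  · simp [h, abs_of_nonneg (sub_nonneg.2 hs)]

theorem isShortestArc_of_dist_eq {X : Type*} {d : X → X → ℝ≥0∞} {γ : ℝ → X}
    (h : ∀ s t, d (γ s) (γ t) = ENNReal.ofReal |t - s|) {s₀ s₁ : ℝ} (hs : s₀ ≤ s₁) :
    IsShortestArc d γ s₀ s₁ where
  le := hs
  continuous t _ := by
    simp only [h]
    have hc : Continuous fun s : ℝ => ENNReal.ofReal |t - s| :=
      ENNReal.continuous_ofReal.comp (by fun_prop)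
    simpa [ContinuousWithinAt] using hc.continuousWithinAt (s := Set.Icc s₀ s₁) (x := t)
  length_ne_top := by simp [metricLength_eq_of_dist_eq h hs]
  length_eq := by rw [metricLength_eq_of_dist_eq h hs, h, abs_of_nonneg (sub_nonneg.2 hs)]

theorem lemma4p1 (β : ℝ) (hβ : β = 0) (φ₀ : ℝ) (g : Matrix (Fin 3) (Fin 3) ℝ)
    (hg : g ∈ lorentzSO) (t₁ : ℝ) (ht₁ : 0 ≤ t₁) :
    (∀ t ∈ Set.Icc 0 t₁, g * lorentzGeodesic β φ₀ t ∈ lorentzSO) ∧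
    (∀ t ∈ Set.Icc 0 t₁,
      metricLength subRiemannianDist (fun s => g * lorentzGeodesic β φ₀ s) 0 t
        = ENNReal.ofReal t) ∧
    IsShortestArc subRiemannianDist (fun s => g * lorentzGeodesic β φ₀ s) 0 t₁ := by
  subst hβ
  have h := subRiemannianDist_lorentzGeodesic_zero hg φ₀
  refine ⟨fun t _ => mul_lorentzGeodesic_zero_mem hg φ₀ t, fun t ht => ?_,
    isShortestArc_of_dist_eq h ht₁⟩
  rw [metricLength_eq_of_dist_eq h ht.1, sub_zero]
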